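/- Call a discrete additive subgroup $\Gamma\subset\mathbb C$ of rank $2$ a lattice, and put $$\wp(z;\Gamma)=\frac1{z^2}+\sum_{u\in\Gamma\setminus\{0\}}\Bigl(\frac1{(z-u)^2}-\frac1{u^2}\Bigr),\quad g_2(\Gamma)=\sum_{u\in\Gamma\setminus\{0\}}\frac{60}{u^4},\quad g_3(\Gamma)=\sum_{u\in\Gamma\setminus\{0\}}\frac{140}{u^6},\quad \Delta(\Gamma)=g_2(\Gamma)^3-27g_3(\Gamma)^2.$$ A subgroup $\Gamma'$ of index $2$ in a lattice $\Gamma$ is called optimal if $|\Delta(\Gamma')|\le|\Delta(G)|$ for every subgroup $G\subset\Gamma$ of index $2$. A sequence $(a_n)_{n\ge 0}$ of complex numbers converges to $a\in\mathbb C$ quadratically fast if $a_n\to a$ and there are $C,q>0$ with $|a_n-a|\le C\exp(-q2^n)$ for all $n\ge0$. Let $\Gamma_0\supset\Gamma_1\supset\Gamma_2\supset\dots$ be subgroups of $\mathbb C$ such that $\Gamma_0$ is a lattice and, for every $i\ge1$, $\Gamma_i$ is an optimal subgroup of index $2$ in $\Gamma_{i-1}$. For each $n\ge0$ let $e_1^{(n)},e_2^{(n)},e_3^{(n)}$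 be the three (distinct) roots of $4x^3-g_2(\Gamma_n)x-g_3(\Gamma_n)$, numbered so that $e_1^{(n)}=\wp(\omega_n/2;\Gamma_n)$ for some $\omega_n\in\Gamma_{n+1}\setminus2\Gamma_n$. Then: (i) $\bigcap_{n\ge0}\Gamma_n$ is a discrete subgroup of $\mathbb C$ of rank $1$, and each of its generators $\varphi$ is a shortest nonzero vector of $\Gamma_0$, i.e. $|\varphi|=\inf\{|w|:w\in\Gamma_0\setminus\{0\}\}$; (ii) the sequence $\Delta(\Gamma_n)$ converges to $0$ quadratically fast; (iii) the sequence $e_2^{(n)}-e_3^{(n)}$ converges to $0$ quadratically fast. -/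

import Mathlib

namespace Landen

/-- A lattice in `ℂ`: a discrete additive subgroup of rank exactly `2`. -/
def IsLattice (Γ : AddSubgroup ℂ) : Prop :=
  DiscreteTopology Γ ∧ Module.finrank ℤ Γ = 2

/-- The Weierstrass function `℘(z; Γ)`. -/
noncomputable def wp (Γ : AddSubgroup ℂ) (z : ℂ) : ℂ :=
  1 / z ^ 2 + ∑' u : {u : ℂ // u ∈ Γ ∧ u ≠ 0}, (1 / (z - (u : ℂ)) ^ 2 - 1 / (u : ℂ) ^ 2)

/-- The invariant `g₂(Γ)`. -/
noncomputable def g₂ (Γ : AddSubgroup ℂ) : ℂ :=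
  ∑' u : {u : ℂ // u ∈ Γ ∧ u ≠ 0}, 60 / (u : ℂ) ^ 4

/-- The invariant `g₃(Γ)`. -/
noncomputable def g₃ (Γ : AddSubgroup ℂ) : ℂ :=
  ∑' u : {u : ℂ // u ∈ Γ ∧ u ≠ 0}, 140 / (u : ℂ) ^ 6

/-- The discriminant `Δ(Γ)`. -/
noncomputable def disc (Γ : AddSubgroup ℂ) : ℂ :=
  g₂ Γ ^ 3 - 27 * g₃ Γ ^ 2

/-- The polynomial `4 x³ - g₂(Γ) x - g₃(Γ)`. -/
noncomputable def cubic (Γ : AddSubgroup ℂ) : Polynomial ℂ :=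
  Polynomial.C 4 * Polynomial.X ^ 3 - Polynomial.C (g₂ Γ) * Polynomial.X - Polynomial.C (g₃ Γ)

/-- `G` is a subgroup of `Γ` of index `2`. -/
def IsIndexTwo (G Γ : AddSubgroup ℂ) : Prop :=
  G ≤ Γ ∧ G.relIndex Γ = 2

/-- `Γ'` is an optimal subgroup of index `2` in `Γ`: it minimizes `|Δ|` among all subgroups
of index `2` in `Γ`. -/
def IsOptimal (Γ' Γ : AddSubgroup ℂ) : Prop :=
  IsIndexTwo Γ' Γ ∧ ∀ G : AddSubgroup ℂ, IsIndexTwo G Γ → ‖disc Γ'‖ ≤ ‖disc G‖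

/-- The sequence `a` converges to `l` quadratically fast. -/
def ConvergesQuadratically (a : ℕ → ℂ) (l : ℂ) : Prop :=
  Filter.Tendsto a Filter.atTop (nhds l) ∧
    ∃ C q : ℝ, 0 < C ∧ 0 < q ∧ ∀ n : ℕ, ‖a n - l‖ ≤ C * Real.exp (-q * 2 ^ n)

end Landen

/-! The key claim is that an optimal subgroup contains a shortest vector of its lattice. If $a$ is
shortest and $G$ contains no shortest vector, then $G=\langle 2a,c\rangle$, where $z=c/a$ can be
arranged to satisfy $|\mathrm{Re}\,z|\le1$ and $|z|>1$. The quotient of the discriminants of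
$\langle a,2c\rangle$ and $\langle 2a,c\rangle$ is `discRatio z`. This region is a fundamental
domain of the group generated by $z\mapsto z+2$ and $z\mapsto-1/z$. There the quotient has modulus
$1$ on the arc $|z|=1$, tends to $0$ at $i\infty$ and has limiting modulus at most $1$ at the cusps
$\pm1$. The maximum principle gives modulus $<1$ (`norm_discRatio_lt_one`), contradicting
optimality.

By finiteness, one shortest $\varphi$ lies in every $\Gamma_n$, so
$\Gamma_n=\langle\varphi,2^n\psi\rangle$ (`exists_chain_basis`) and the intersection is $\mathbb
Z\varphi$. The period ratio is $2^n\psi/\varphi$, so $q$-expansions give the decay of $\Delta$ and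
of $(e_2-e_3)^2=g_2-3e_1^2$. -/

namespace Landen

open Complex Filter Topology

/-! ### The modular discriminant: transformation laws and behaviour at the cusp. -/

/-- The modular discriminant `η(z) ^ 24` as a function of a complex variable. -/
noncomputable def modDisc (z : ℂ) : ℂ := ModularForm.eta z ^ 24

lemma modDisc_coe (z : UpperHalfPlane) : modDisc z = ModularForm.discriminant z := rfl

lemma modDisc_ne_zero {z : ℂ} (hz : 0 < z.im) : modDisc z ≠ 0 :=
  ModularForm.discriminant_ne_zero ⟨z, hz⟩

lemma differentiableAt_modDisc {z : ℂ} (hz : 0 < z.im) : DifferentiableAt ℂ modDisc z :=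
  (ModularForm.differentiableAt_eta_of_mem_upperHalfPlaneSet hz).pow 24

lemma modDisc_eq_prod {z : ℂ} (hz : 0 < z.im) :
    modDisc z = Function.Periodic.qParam 1 z * ∏' n, (1 - ModularForm.eta_q n z) ^ 24 :=
  ModularForm.discriminant_eq_q_prod ⟨z, hz⟩

lemma modDisc_add_one {z : ℂ} (hz : 0 < z.im) : modDisc (z + 1) = modDisc z := by
  have h : Function.Periodic.qParam 1 (z + 1) = Function.Periodic.qParam 1 z := by
    simp only [Function.Periodic.qParam, ofReal_one, div_one, mul_add, mul_one]
    exact exp_periodic _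
  have hz' : 0 < (z + 1).im := by simpa using hz
  rw [modDisc_eq_prod hz, modDisc_eq_prod hz']
  simp only [ModularForm.eta_q, h]

lemma sqrt_pow_twentyfour {z : ℂ} (hz : z ≠ 0) : z.sqrt ^ 24 = z ^ 12 := by
  rw [sqrt_eq_exp hz, ← exp_nat_mul,
    show ((24 : ℕ) : ℂ) * (log z / 2) = (12 : ℕ) * log z by push_cast; ring, exp_nat_mul,
    exp_log hz]

lemma modDisc_neg_inv {z : ℂ} (hz : 0 < z.im) : modDisc (-1 / z) = z ^ 12 * modDisc z := by
  have hz0 : z ≠ 0 := by rintro rfl; simp at hz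
  have h := ModularForm.eta_comp_eq_csqrt_I_inv hz
  simp only [Function.comp_apply, Pi.smul_apply, Pi.mul_apply, smul_eq_mul] at h
  rw [modDisc, h, modDisc, mul_pow, mul_pow, inv_pow, sqrt_pow_twentyfour I_ne_zero,
    sqrt_pow_twentyfour hz0, show (12 : ℕ) = 4 * 3 by norm_num, pow_mul I, I_pow_four]
  simp

/-- Replacing $z$ by $-\bar z$ conjugates $q$, and the product in $q$ has real coefficients. -/
lemma modDisc_neg_conj {z : ℂ} (hz : 0 < z.im) :
    modDisc (-(starRingEnd ℂ) z) = (starRingEnd ℂ) (modDisc z) := by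
  have hq (h : ℝ) : Function.Periodic.qParam h (-(starRingEnd ℂ) z) =
      (starRingEnd ℂ) (Function.Periodic.qParam h z) := by
    simp only [Function.Periodic.qParam, ← Complex.exp_conj]
    simp only [map_div₀, map_mul, conj_ofReal, conj_I, map_ofNat]
    ring_nf
  have hm : Multipliable fun n ↦ 1 - ModularForm.eta_q n z :=
    ModularForm.multipliableLocallyUniformlyOn_eta.multipliable hz
  rw [modDisc, modDisc, ModularForm.eta, ModularForm.eta, map_pow, map_mul,
    hm.map_tprod (starRingEnd ℂ) Complex.continuous_conj, hq]
  simp only [ModularForm.eta_q, hq, map_sub, map_one, map_pow]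

lemma norm_modDisc_asymptotic {ε : ℝ} (hε : 0 < ε) :
    ∃ T : ℝ, ∀ z : ℂ, 0 < z.im → T ≤ z.im →
      (1 - ε) * Real.exp (-2 * Real.pi * z.im) ≤ ‖modDisc z‖ ∧
      ‖modDisc z‖ ≤ (1 + ε) * Real.exp (-2 * Real.pi * z.im) := by
  have h := ModularForm.tendsto_atImInfty_tprod_one_sub_eta_q_pow.norm
  rw [norm_one] at h
  have h2 := h.eventually (Metric.ball_mem_nhds 1 hε)
  obtain ⟨T, hT⟩ := (UpperHalfPlane.atImInfty_mem _).1 h2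
  refine ⟨T, fun z hz hTz ↦ ?_⟩
  have h3 := hT ⟨z, hz⟩ hTz
  simp only [Set.mem_ofPred_eq, Real.dist_eq, abs_lt] at h3
  have hq : ‖Function.Periodic.qParam 1 z‖ = Real.exp (-2 * Real.pi * z.im) := by
    rw [Function.Periodic.norm_qParam]; simp
  rw [modDisc_eq_prod hz, norm_mul, hq, mul_comm]
  constructor
  · gcongr
    linarith [h3.1]
  · rw [mul_comm]; gcongr
    linarith [h3.2]

/-! ### The discriminant quotient and the maximum principle. -/

/-- The quotient of the discriminants of `⟨1, 2z⟩` and `⟨2, z⟩`. -/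
noncomputable def discRatio (z : ℂ) : ℂ := 2 ^ 12 * modDisc (2 * z) / modDisc (z / 2)

lemma im_two_mul_pos {z : ℂ} (hz : 0 < z.im) : 0 < (2 * z).im := by simpa using hz

lemma im_half_pos {z : ℂ} (hz : 0 < z.im) : 0 < (z / 2).im := by simpa using hz

lemma discRatio_ne_zero {z : ℂ} (hz : 0 < z.im) : discRatio z ≠ 0 :=
  div_ne_zero (mul_ne_zero (by norm_num) (modDisc_ne_zero (im_two_mul_pos hz)))
    (modDisc_ne_zero (im_half_pos hz))

lemma differentiableAt_discRatio {z : ℂ} (hz : 0 < z.im) : DifferentiableAt ℂ discRatio z := by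
  unfold discRatio
  refine DifferentiableAt.div (DifferentiableAt.const_mul ?_ _) ?_ (modDisc_ne_zero (im_half_pos hz))
  · exact DifferentiableAt.comp (f := fun w : ℂ ↦ 2 * w) z (differentiableAt_modDisc (im_two_mul_pos hz))
      (by fun_prop)
  · exact DifferentiableAt.comp (f := fun w : ℂ ↦ w / 2) z (differentiableAt_modDisc (im_half_pos hz))
      (by fun_prop)

lemma discRatio_add_two {z : ℂ} (hz : 0 < z.im) : discRatio (z + 2) = discRatio z := by
  have h1 : modDisc (2 * (z + 2)) = modDisc (2 * z) := by
    rw [show 2 * (z + 2) = 2 * z + 1 + 1 + 1 + 1 by ring, modDisc_add_one, modDisc_add_one,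
      modDisc_add_one, modDisc_add_one] <;> simpa using hz
  have h2 : modDisc ((z + 2) / 2) = modDisc (z / 2) := by
    rw [show (z + 2) / 2 = z / 2 + 1 by ring, modDisc_add_one (im_half_pos hz)]
  rw [discRatio, h1, h2, discRatio]

lemma discRatio_sub_two {z : ℂ} (hz : 0 < z.im) : discRatio (z - 2) = discRatio z := by
  rw [← discRatio_add_two (z := z - 2) (by simpa using hz), sub_add_cancel]

/-- Inversion exchanges $2z$ and $z/2$, since $2(-1/z)=-1/(z/2)$; the weight factors cancel against
$2^{12}$. -/
lemma discRatio_neg_inv {z : ℂ} (hz : 0 < z.im) : discRatio (-1 / z) = (discRatio z)⁻¹ := by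
  have hz0 : z ≠ 0 := by rintro rfl; simp at hz
  have h1 : modDisc (2 * (-1 / z)) = (z / 2) ^ 12 * modDisc (z / 2) := by
    rw [← modDisc_neg_inv (im_half_pos hz)]; congr 1; field_simp
  have h2 : modDisc (-1 / z / 2) = (2 * z) ^ 12 * modDisc (2 * z) := by
    rw [← modDisc_neg_inv (im_two_mul_pos hz)]; congr 1; field_simp
  have := modDisc_ne_zero (im_half_pos hz)
  have := modDisc_ne_zero (im_two_mul_pos hz)
  rw [discRatio, discRatio, h1, h2]
  field_simp

lemma discRatio_neg_conj {z : ℂ} (hz : 0 < z.im) :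
    discRatio (-(starRingEnd ℂ) z) = (starRingEnd ℂ) (discRatio z) := by
  have h1 := modDisc_neg_conj (im_two_mul_pos hz)
  have h2 := modDisc_neg_conj (im_half_pos hz)
  rw [map_mul, ← mul_neg] at h1
  rw [map_div₀, ← neg_div] at h2
  simp only [map_ofNat] at h1 h2
  simp only [discRatio, h1, h2, map_div₀, map_mul, map_pow, map_ofNat]

lemma norm_discRatio_of_norm_eq_one {z : ℂ} (hz : 0 < z.im) (h : ‖z‖ = 1) :
    ‖discRatio z‖ = 1 := by
  have hz0 : z ≠ 0 := by rintro rfl; simp at hz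
  -- On the unit circle inversion is the reflection $z\mapsto-\bar z$, so the modulus equals its own
  -- inverse.
  have h1 : -1 / z = -(starRingEnd ℂ) z := by
    rw [neg_div, neg_inj, div_eq_iff hz0, mul_comm, Complex.mul_conj', h]; simp
  have h2 := discRatio_neg_inv hz
  rw [h1, discRatio_neg_conj hz] at h2
  have h3 := congrArg norm h2
  rw [RCLike.norm_conj, norm_inv] at h3
  have h4 : ‖discRatio z‖ ≠ 0 := norm_ne_zero_iff.2 (discRatio_ne_zero hz)
  field_simp at h3
  nlinarith [norm_nonneg (discRatio z)]

/-- The cusp $1$ is moved to $i\infty$. The two arguments on the right have the same imaginary part,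
so the modulus tends to $1$ there. -/
lemma discRatio_one_sub_inv {w : ℂ} (hw : 0 < w.im) :
    discRatio (1 - 1 / w) = modDisc (w / 2) / modDisc ((w + 1) / 2) := by
  have hw0 : w ≠ 0 := by rintro rfl; simp at hw
  have hv : 0 < ((w + 1) / 2).im := by simpa using hw
  have hS : 0 < (-1 / (w / 2)).im := by
    rw [neg_div, one_div, neg_im, inv_im, neg_div, neg_neg]
    exact div_pos (im_half_pos hw) (normSq_pos.2 (by simpa using hw0))
  have h1 : modDisc (2 * (1 - 1 / w)) = (w / 2) ^ 12 * modDisc (w / 2) := by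
    rw [← modDisc_neg_inv (im_half_pos hw), show 2 * (1 - 1 / w) = -1 / (w / 2) + 1 + 1 by
      field_simp; ring, modDisc_add_one, modDisc_add_one hS]
    simpa using hS
  have h2 : modDisc ((1 - 1 / w) / 2) = w ^ 12 * modDisc ((w + 1) / 2) := by
    set v := (w + 1) / 2 with hvdef
    have hv0 : v ≠ 0 := by intro h; rw [h] at hv; simp at hv
    have hwv : w = 2 * v - 1 := by rw [hvdef]; ring
    have hS1 : 0 < (-1 / v).im := by
      rw [neg_div, one_div, neg_im, inv_im, neg_div, neg_neg]
      exact div_pos hv (normSq_pos.2 hv0)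
    have hS2 : 0 < (-1 / v + 1 + 1).im := by simpa using hS1
    -- The map $v\mapsto(1-1/w)/2$ is the word $TST^2S$ in $T:z\mapsto z+1$ and $S:z\mapsto-1/z$.
    have e : (1 - 1 / w) / 2 = -1 / (-1 / v + 1 + 1) + 1 := by
      rw [hwv] at hw0 ⊢
      have : -1 / v + 1 + 1 = (2 * v - 1) / v := by field_simp; ring
      rw [this]; field_simp; ring
    have hS3 : 0 < (-1 / (-1 / v + 1 + 1)).im := by
      rw [neg_div, one_div, neg_im, inv_im, neg_div, neg_neg]
      exact div_pos hS2 (normSq_pos.2 (by intro h; rw [h] at hS2; simp at hS2))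
    rw [e, modDisc_add_one hS3, modDisc_neg_inv hS2,
      modDisc_add_one (by simpa using hS1), modDisc_add_one hS1, modDisc_neg_inv hv,
      ← mul_assoc, ← mul_pow]
    congr 2
    rw [hwv]; field_simp; ring
  have := modDisc_ne_zero hv
  rw [discRatio, h1, h2]
  field_simp

lemma norm_discRatio_le_of_im_large {c : ℝ} (hc : 0 < c) :
    ∃ T : ℝ, 0 < T ∧ ∀ z : ℂ, T ≤ z.im → ‖discRatio z‖ < c := by
  obtain ⟨T, hT⟩ := norm_modDisc_asymptotic (ε := 1 / 2) (by norm_num)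
  -- Numerator and denominator decay like $e^{-4\pi y}$ and $e^{-\pi y}$; $12288=2^{12}\cdot3$ with
  -- $3=(1+\frac12)/(1-\frac12)$.
  have hlim : Tendsto (fun y : ℝ ↦ 12288 * Real.exp (-(3 * Real.pi * y))) atTop (𝓝 (12288 * 0)) := by
    refine Tendsto.const_mul _ (Real.tendsto_exp_neg_atTop_nhds_zero.comp ?_)
    exact tendsto_id.const_mul_atTop (by positivity)
  rw [mul_zero] at hlim
  obtain ⟨T', hT'⟩ := eventually_atTop.1 (hlim.eventually (gt_mem_nhds hc))
  refine ⟨max (max T' (2 * |T|)) 1, by positivity, fun z hz ↦ ?_⟩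
  have h1 : T' ≤ z.im := (le_max_left _ _).trans ((le_max_left _ _).trans hz)
  have h2 : 2 * |T| ≤ z.im := (le_max_right _ _).trans ((le_max_left _ _).trans hz)
  have h3 : 0 < z.im := lt_of_lt_of_le one_pos ((le_max_right _ _).trans hz)
  have h4 := le_abs_self T
  have h5 := abs_nonneg T
  obtain ⟨-, ha⟩ := hT (2 * z) (im_two_mul_pos h3) (by simp; linarith)
  obtain ⟨hb, -⟩ := hT (z / 2) (im_half_pos h3) (by simp; linarith)
  have ea : (2 * z).im = 2 * z.im := by simp
  have eb : (z / 2).im = z.im / 2 := by simp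
  rw [ea] at ha
  rw [eb] at hb
  refine lt_of_le_of_lt ?_ (hT' _ h1)
  have hpos := norm_pos_iff.2 (modDisc_ne_zero (im_half_pos h3))
  rw [discRatio, norm_div, norm_mul, div_le_iff₀ hpos]
  have e1 : Real.exp (-2 * Real.pi * (2 * z.im)) =
      Real.exp (-(3 * Real.pi * z.im)) * Real.exp (-2 * Real.pi * (z.im / 2)) := by
    rw [← Real.exp_add]; congr 1; ring
  rw [e1] at ha
  have := mul_le_mul_of_nonneg_left hb (Real.exp_pos (-(3 * Real.pi * z.im))).le
  norm_num
  nlinarith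

lemma norm_discRatio_lt_near_cusp {c : ℝ} (hc : 1 < c) :
    ∃ δ : ℝ, 0 < δ ∧ ∀ z : ℂ, 0 < z.im → z.im < δ → |z.re| ≤ 1 → 1 ≤ ‖z‖ → ‖discRatio z‖ < c := by
  -- $\varepsilon=(c-1)/(c+1)$ would give $(1+\varepsilon)/(1-\varepsilon)=c$; half of it makes the
  -- inequality strict.
  have hε : 0 < (c - 1) / (c + 1) / 2 := div_pos (div_pos (by linarith) (by linarith)) two_pos
  obtain ⟨T, hT⟩ := norm_modDisc_asymptotic hε
  have key : ∀ w : ℂ, 0 < w.im → 2 * T ≤ w.im → ‖discRatio (1 - 1 / w)‖ < c := by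
    intro w hw hTw
    have e1 : (w / 2).im = w.im / 2 := by simp
    have e2 : ((w + 1) / 2).im = w.im / 2 := by simp
    obtain ⟨-, ha⟩ := hT (w / 2) (im_half_pos hw) (by rw [e1]; linarith)
    obtain ⟨hb, -⟩ := hT ((w + 1) / 2) (by rw [e2]; linarith) (by rw [e2]; linarith)
    rw [e1] at ha
    rw [e2] at hb
    have hpos := norm_pos_iff.2 (modDisc_ne_zero (z := (w + 1) / 2) (by rw [e2]; linarith))
    rw [discRatio_one_sub_inv hw, norm_div, div_lt_iff₀ hpos]
    refine lt_of_le_of_lt ha (lt_of_lt_of_le ?_ (mul_le_mul_of_nonneg_left hb (by linarith)))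
    rw [← mul_assoc]
    refine mul_lt_mul_of_pos_right ?_ (Real.exp_pos _)
    have : (c - 1) / (c + 1) * (c + 1) = c - 1 := div_mul_cancel₀ _ (by linarith)
    nlinarith
  have key2 : ∀ z : ℂ, 0 < z.im → z.im < 1 / (4 * |T| + 1) → 0 ≤ z.re → z.re ≤ 1 → 1 ≤ ‖z‖ →
      ‖discRatio z‖ < c := by
    intro z hz hzδ h0 h1 hn
    have hT0 := abs_nonneg T
    have hy1 : z.im * (4 * |T| + 1) < 1 := (lt_div_iff₀ (by positivity)).1 hzδ
    have hn2 : 1 ≤ z.re ^ 2 + z.im ^ 2 := by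
      have : 1 ≤ ‖z‖ ^ 2 := one_le_pow₀ hn
      rwa [Complex.sq_norm, normSq_apply, ← sq, ← sq] at this
    have hne : 1 - z ≠ 0 := by
      intro h; have := congrArg im h; simp at this; linarith
    have hns : normSq (1 - z) = (1 - z.re) ^ 2 + z.im ^ 2 := by
      rw [normSq_apply]; simp; ring
    have hnpos := normSq_pos.2 hne
    have him : (1 / (1 - z)).im = z.im / normSq (1 - z) := by
      rw [one_div, inv_im]; simp
    have hw : 0 < (1 / (1 - z)).im := by rw [him]; exact div_pos hz hnpos
    have e : z = 1 - 1 / (1 / (1 - z)) := by simp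
    rw [e]
    refine key _ hw ?_
    rw [him, le_div_iff₀ hnpos, hns]
    have hy2 : z.im < 1 := by nlinarith
    -- Since $1-x\le1-x^2\le y^2$, the domain is thin near the cusp, and $w=1/(1-z)$ has imaginary
    -- part at least $1/(2y)$.
    have hx : 1 - z.re ≤ z.im ^ 2 := by nlinarith
    have hx2 : (1 - z.re) ^ 2 ≤ z.im ^ 2 := by
      have : z.im ^ 2 ≤ z.im := by nlinarith
      exact pow_le_pow_left₀ (by linarith) (hx.trans this) 2
    have hTle := le_abs_self T
    have h5 : 2 * T * ((1 - z.re) ^ 2 + z.im ^ 2) ≤ 2 * |T| * (2 * z.im ^ 2) := by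
      have : (1 - z.re) ^ 2 + z.im ^ 2 ≤ 2 * z.im ^ 2 := by linarith
      exact mul_le_mul (by linarith) this (by positivity) (by positivity)
    nlinarith
  refine ⟨1 / (4 * |T| + 1), by positivity, fun z hz hzδ hre hn ↦ ?_⟩
  rcases le_total 0 z.re with h | h
  · exact key2 z hz hzδ h ((le_abs_self _).trans hre) hn
  · have := key2 (-(starRingEnd ℂ) z) (by simpa using hz) (by simpa using hzδ) (by simpa using h)
      (by simpa using (neg_le_abs _).trans hre) (by simpa using hn)
    rwa [discRatio_neg_conj hz, RCLike.norm_conj] at this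

/-- A local maximum would make the function constant on the half plane, against its decay at
$i\infty$. -/
lemma not_isLocalMax_norm_discRatio {z : ℂ} (hz : 0 < z.im) :
    ¬ IsLocalMax (norm ∘ discRatio) z := by
  intro hmax
  have hopen : IsOpen {w : ℂ | 0 < w.im} := isOpen_lt continuous_const continuous_im
  have h1 := Complex.eventually_eq_of_isLocalMax_norm
    ((hopen.eventually_mem hz).mono fun w hw ↦ differentiableAt_discRatio hw) hmax
  have han : AnalyticOnNhd ℂ discRatio {w : ℂ | 0 < w.im} :=
    DifferentiableOn.analyticOnNhd
      (fun w hw ↦ (differentiableAt_discRatio hw).differentiableWithinAt) hopen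
  have heq := han.eqOn_of_preconnected_of_eventuallyEq
    (g := fun _ ↦ discRatio z) analyticOnNhd_const (convex_halfSpace_im_gt 0).isPreconnected hz h1
  obtain ⟨T, hT0, hT⟩ := norm_discRatio_le_of_im_large (norm_pos_iff.2 (discRatio_ne_zero hz))
  have h2 := hT (T * I) (by simp)
  rw [heq (by simpa using hT0 : (T * I : ℂ) ∈ {w : ℂ | 0 < w.im})] at h2
  exact lt_irrefl _ h2

/-- A maximum over the domain would be a local one: near the sides $\mathrm{Re}\,z=\pm1$, points
that leave the strip return by a translation by $\pm2$ and stay outside the unit disc. -/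
lemma not_forall_norm_discRatio_le {z : ℂ} (hz : 0 < z.im) (hre : |z.re| ≤ 1) (hn : 1 < ‖z‖) :
    ¬ ∀ w : ℂ, 0 < w.im → |w.re| ≤ 1 → 1 < ‖w‖ → ‖discRatio w‖ ≤ ‖discRatio z‖ := by
  intro hle
  apply not_isLocalMax_norm_discRatio hz
  have sq (w : ℂ) : ‖w‖ ^ 2 = w.re ^ 2 + w.im ^ 2 := by
    rw [Complex.sq_norm, normSq_apply]; ring
  rw [abs_le] at hre
  have hm : 1 < ‖z - 2‖ := by
    have h1 := sq z
    have h2 := sq (z - 2)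
    simp only [sub_re, sub_im, re_ofNat, im_ofNat] at h2
    nlinarith [norm_nonneg (z - 2), norm_nonneg z]
  have hp : 1 < ‖z + 2‖ := by
    have h1 := sq z
    have h2 := sq (z + 2)
    simp only [add_re, add_im, re_ofNat, im_ofNat] at h2
    nlinarith [norm_nonneg (z + 2), norm_nonneg z]
  have e1 : ∀ᶠ w in 𝓝 z, 0 < w.im := (isOpen_lt continuous_const continuous_im).mem_nhds hz
  have e2 : ∀ᶠ w in 𝓝 z, 1 < ‖w‖ := (isOpen_lt continuous_const continuous_norm).mem_nhds hn
  have e3 : ∀ᶠ w in 𝓝 z, 1 < ‖w - 2‖ :=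
    (isOpen_lt continuous_const (by fun_prop : Continuous fun w : ℂ ↦ ‖w - 2‖)).mem_nhds hm
  have e4 : ∀ᶠ w in 𝓝 z, 1 < ‖w + 2‖ :=
    (isOpen_lt continuous_const (by fun_prop : Continuous fun w : ℂ ↦ ‖w + 2‖)).mem_nhds hp
  have e5 : ∀ᶠ w in 𝓝 z, w.re < 2 :=
    (isOpen_lt continuous_re continuous_const).mem_nhds (show z.re < 2 by linarith)
  have e6 : ∀ᶠ w in 𝓝 z, -2 < w.re :=
    (isOpen_lt continuous_const continuous_re).mem_nhds (show -2 < z.re by linarith)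
  filter_upwards [e1, e2, e3, e4, e5, e6] with w h1 h2 h3 h4 h5 h6
  simp only [Function.comp_apply]
  rcases lt_or_ge 1 w.re with h | h
  · rw [← discRatio_sub_two h1]
    exact hle _ (by simpa using h1) (by rw [abs_le]; constructor <;> simp <;> linarith) h3
  rcases lt_or_ge w.re (-1) with h' | h'
  · rw [← discRatio_add_two h1]
    exact hle _ (by simpa using h1) (by rw [abs_le]; constructor <;> simp <;> linarith) h4
  exact hle w h1 (abs_le.2 ⟨h', h⟩) h2

lemma norm_discRatio_le_one {z : ℂ} (hz : 0 < z.im) (hre : |z.re| ≤ 1) (hn : 1 < ‖z‖) :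
    ‖discRatio z‖ ≤ 1 := by
  by_contra! hc
  obtain ⟨T, hT0, hT⟩ := norm_discRatio_le_of_im_large (c := ‖discRatio z‖) (by linarith)
  obtain ⟨δ, hδ0, hδ⟩ := norm_discRatio_lt_near_cusp hc
  -- Points of the domain with values at least `‖discRatio z‖ > 1` avoid both the cusps and
  -- $i\infty$, so the maximum is attained on a compact set, off the unit circle.
  let K : Set ℂ := (Set.Icc (-1) 1 ×ℂ Set.Icc δ T) ∩ {w | 1 ≤ ‖w‖}
  have hK : IsCompact K :=
    (isCompact_Icc.reProdIm isCompact_Icc).inter_right (isClosed_le continuous_const continuous_norm)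
  have him : ∀ w ∈ K, 0 < w.im := fun w hw ↦ hδ0.trans_le hw.1.2.1
  have hmem : ∀ w : ℂ, 0 < w.im → |w.re| ≤ 1 → 1 ≤ ‖w‖ → ‖discRatio z‖ ≤ ‖discRatio w‖ →
      w ∈ K := by
    intro w h1 h2 h3 h4
    refine ⟨⟨abs_le.1 h2, ?_, ?_⟩, h3⟩
    · by_contra! h
      exact absurd (hδ w h1 h h2 h3) (not_lt.2 h4)
    · by_contra! h
      exact absurd (hT w h.le) (not_lt.2 h4)
  obtain ⟨m, hmK, hm⟩ := hK.exists_isMaxOn ⟨z, hmem z hz hre hn.le le_rfl⟩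
    (f := fun w ↦ ‖discRatio w‖)
    (fun w hw ↦ (differentiableAt_discRatio (him w hw)).continuousAt.norm.continuousWithinAt)
  have hzm : ‖discRatio z‖ ≤ ‖discRatio m‖ := hm (hmem z hz hre hn.le le_rfl)
  have hm1 : 1 < ‖m‖ := by
    refine lt_of_le_of_ne hmK.2 fun h ↦ ?_
    have := norm_discRatio_of_norm_eq_one (him m hmK) h.symm
    linarith
  refine not_forall_norm_discRatio_le (him m hmK) (abs_le.2 hmK.1.1) hm1 fun w h1 h2 h3 ↦ ?_
  rcases le_total ‖discRatio w‖ ‖discRatio z‖ with h | h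
  · exact h.trans hzm
  · exact hm (hmem w h1 h2 h3.le h)

theorem norm_discRatio_lt_one {z : ℂ} (hz : 0 < z.im) (hre : |z.re| ≤ 1) (hn : 1 < ‖z‖) :
    ‖discRatio z‖ < 1 := by
  refine lt_of_le_of_ne (norm_discRatio_le_one hz hre hn) fun h ↦ ?_
  refine not_forall_norm_discRatio_le hz hre hn fun w h1 h2 h3 ↦ ?_
  rw [h]
  exact norm_discRatio_le_one h1 h2 h3

end Landen

/-! ### Lattice invariants as Eisenstein series. -/

namespace Landen

open Complex Filter Topology EisensteinSeries SummationFilter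

/-- The subgroup of `ℂ` generated by two complex numbers. -/
def periodLattice (a b : ℂ) : AddSubgroup ℂ := AddSubgroup.closure {a, b}

lemma mem_periodLattice {a b z : ℂ} :
    z ∈ periodLattice a b ↔ ∃ m n : ℤ, (m : ℂ) * a + n * b = z := by
  simp [periodLattice, AddSubgroup.mem_closure_pair]

lemma ne_zero_of_im_div_ne_zero {a b : ℂ} (h : (b / a).im ≠ 0) : a ≠ 0 := by
  rintro rfl; simp at h

lemma real_coeffs_eq_zero {a b : ℂ} (h : (b / a).im ≠ 0) {s t : ℝ}
    (hst : (s : ℂ) * a + t * b = 0) : s = 0 ∧ t = 0 := by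
  have ha := ne_zero_of_im_div_ne_zero h
  have h1 : (s : ℂ) + t * (b / a) = 0 := by
    have := congrArg (· / a) hst
    simp only [zero_div] at this
    rw [← this]; field_simp
  have h2 := congrArg im h1
  simp only [add_im, ofReal_im, im_ofReal_mul, zero_add, zero_im] at h2
  have ht : t = 0 := (mul_eq_zero.1 h2).resolve_right h
  have h3 := congrArg re h1
  simp [ht] at h3
  exact ⟨h3, ht⟩

lemma int_coeffs_eq {a b : ℂ} (h : (b / a).im ≠ 0) {m n p q : ℤ}
    (e : (m : ℂ) * a + n * b = p * a + q * b) : m = p ∧ n = q := by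
  have := real_coeffs_eq_zero h (s := (m - p : ℤ)) (t := (n - q : ℤ))
    (by push_cast; linear_combination e)
  constructor
  · have := this.1; norm_cast at this; omega
  · have := this.2; norm_cast at this; omega

/-- The pair of periods `(b, a)` for `b / a` not real. -/
noncomputable def periodPair (a b : ℂ) (h : (b / a).im ≠ 0) : PeriodPair where
  ω₁ := b
  ω₂ := a
  indep := by
    rw [LinearIndependent.pair_iff]
    intro s t hst
    have := real_coeffs_eq_zero h (s := t) (t := s) (by simpa [add_comm] using hst)
    exact ⟨this.2, this.1⟩

lemma mem_lattice_periodPair {a b : ℂ} (h : (b / a).im ≠ 0) {z : ℂ} :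
    z ∈ (periodPair a b h).lattice ↔ z ∈ periodLattice a b := by
  rw [PeriodPair.mem_lattice, mem_periodLattice, exists_comm]
  simp [periodPair, add_comm]

lemma tsum_periodLattice {a b : ℂ} (h : (b / a).im ≠ 0) (f : ℂ → ℂ) (hf : f 0 = 0) :
    ∑' u : {u : ℂ // u ∈ periodLattice a b ∧ u ≠ 0}, f u =
      ∑' x : ℤ × ℤ, f (x.1 * b + x.2 * a) := by
  have hinj : Function.Injective (fun x : ℤ × ℤ ↦ (x.1 : ℂ) * b + x.2 * a) := by
    rintro ⟨m, n⟩ ⟨p, q⟩ e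
    have := int_coeffs_eq h (m := n) (n := m) (p := q) (q := p) (by
      simp only at e; linear_combination e)
    simp [this.1, this.2]
  have h1 := tsum_subtype {u : ℂ | u ∈ periodLattice a b ∧ u ≠ 0} f
  refine h1.trans ?_
  rw [← hinj.tsum_eq]
  · refine tsum_congr fun x ↦ ?_
    by_cases hx : (x.1 : ℂ) * b + x.2 * a = 0
    · simp [hx, hf]
    · rw [Set.indicator_of_mem]
      exact ⟨mem_periodLattice.2 ⟨x.2, x.1, by ring⟩, hx⟩
  · intro u hu
    have hu' := Set.mem_of_indicator_ne_zero hu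
    obtain ⟨m, n, e⟩ := mem_periodLattice.1 hu'.1
    exact ⟨(n, m), by simp only; rw [← e]; ring⟩

lemma tsum_div_pow_periodLattice {a b : ℂ} (τ : UpperHalfPlane) (hτ : b / a = τ) {k : ℕ}
    (hk : 3 ≤ k) (c : ℂ) :
    ∑' u : {u : ℂ // u ∈ periodLattice a b ∧ u ≠ 0}, c / (u : ℂ) ^ k =
      2 * c * riemannZeta k / a ^ k * ModularForm.E hk τ := by
  have h : (b / a).im ≠ 0 := by rw [hτ]; exact τ.im_pos.ne'
  have ha := ne_zero_of_im_div_ne_zero h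
  -- The added term at the origin is $c/0=0$.
  rw [tsum_periodLattice h (fun u ↦ c / u ^ k) (by simp [show k ≠ 0 by omega])]
  have hE : ModularForm.E hk τ = 1 / 2 * eisensteinSeries (N := 1) 0 k τ := rfl
  have h2 := tsum_eisSummand_eq_riemannZeta_mul_eisensteinSeries hk τ
  rw [← (finTwoArrowEquiv ℤ).symm.tsum_eq] at h2
  have h3 : ∀ x : ℤ × ℤ, c / ((x.1 : ℂ) * b + x.2 * a) ^ k =
      c / a ^ k * eisSummand k ((finTwoArrowEquiv ℤ).symm x) τ := by
    intro x
    have e : (x.1 : ℂ) * b + x.2 * a = a * (x.1 * τ + x.2) := by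
      rw [← hτ]; field_simp
    rw [e, mul_pow]
    simp [eisSummand, finTwoArrowEquiv_symm_apply, div_eq_mul_inv]
    ring
  simp_rw [h3]
  rw [tsum_mul_left, h2, hE]
  ring

lemma riemannZeta_six : riemannZeta 6 = Real.pi ^ 6 / 945 := by
  have hB : bernoulli 6 = 1 / 42 := by
    rw [bernoulli_eq_bernoulli'_of_ne_one (by norm_num), bernoulli'_def]
    norm_num [Finset.sum_range_succ, Nat.choose,
      bernoulli'_eq_zero_of_odd (n := 5) (by decide) (by norm_num)]
  have h := riemannZeta_two_mul_nat (k := 3) (by norm_num)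
  norm_num [hB, Nat.factorial] at h
  rw [h]; ring

lemma g₂_periodLattice {a b : ℂ} (τ : UpperHalfPlane) (hτ : b / a = τ) :
    g₂ (periodLattice a b) = 4 * Real.pi ^ 4 / 3 / a ^ 4 * ModularForm.E₄ τ := by
  rw [g₂, tsum_div_pow_periodLattice τ hτ (by norm_num), Nat.cast_ofNat, riemannZeta_four]
  ring

lemma g₃_periodLattice {a b : ℂ} (τ : UpperHalfPlane) (hτ : b / a = τ) :
    g₃ (periodLattice a b) = 8 * Real.pi ^ 6 / 27 / a ^ 6 * ModularForm.E₆ τ := by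
  rw [g₃, tsum_div_pow_periodLattice τ hτ (by norm_num), Nat.cast_ofNat, riemannZeta_six]
  ring

/-- The discriminant of a lattice in terms of the modular discriminant. -/
theorem disc_periodLattice {a b : ℂ} (h : 0 < (b / a).im) :
    disc (periodLattice a b) = (2 * Real.pi / a) ^ 12 * modDisc (b / a) := by
  have h1 := ModularForm.discriminant_eq_E₄_cube_sub_E₆_sq ⟨b / a, h⟩
  rw [← modDisc_coe] at h1
  rw [disc, g₂_periodLattice ⟨b / a, h⟩ rfl, g₃_periodLattice ⟨b / a, h⟩ rfl]
  change modDisc (b / a) = _ at h1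
  rw [h1]
  ring

lemma wp_periodLattice {a b : ℂ} (h : (b / a).im ≠ 0) (z : ℂ) :
    wp (periodLattice a b) z = (periodPair a b h).weierstrassP z := by
  rw [← (periodPair a b h).weierstrassPExcept_add 0 z, wp, PeriodPair.weierstrassPExcept, add_comm]
  congr 1
  · have e1 := tsum_subtype {u : ℂ | u ∈ periodLattice a b ∧ u ≠ 0}
      (fun l : ℂ ↦ 1 / (z - l) ^ 2 - 1 / l ^ 2)
    have e2 := tsum_subtype ((periodPair a b h).lattice : Set ℂ)
      (fun l : ℂ ↦ if l = 0 then 0 else 1 / (z - l) ^ 2 - 1 / l ^ 2)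
    refine e1.trans (Eq.trans ?_ e2.symm)
    congr 1
    ext u
    by_cases hu : u ∈ periodLattice a b
    · by_cases hu0 : u = 0
      · simp [hu0]
      · rw [Set.indicator_of_mem (show u ∈ {u : ℂ | u ∈ periodLattice a b ∧ u ≠ 0} from ⟨hu, hu0⟩),
          Set.indicator_of_mem ((mem_lattice_periodPair h).2 hu), if_neg hu0]
    · rw [Set.indicator_of_notMem (fun hu' ↦ hu hu'.1),
        Set.indicator_of_notMem (fun hu' ↦ hu ((mem_lattice_periodPair h).1 hu'))]
  · simp

/-! ### The value of $\wp$ at a half period. -/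

lemma tsum_int_even_add_odd {f : ℤ → ℂ} (hf : Summable f) :
    ∑' k, f k = ∑' n : ℤ, (f (2 * n) + f (2 * n + 1)) := by
  rw [← (Int.divModEquiv 2).symm.tsum_eq]
  have hs : Summable fun p : ℤ × Fin 2 ↦ f ((Int.divModEquiv 2).symm p) :=
    (Int.divModEquiv 2).symm.summable_iff.2 hf
  rw [hs.tsum_prod]
  refine tsum_congr fun n ↦ ?_
  rw [tsum_fintype, Fin.sum_univ_two]
  simp [Int.divModEquiv, mul_comm]

/-- The point `2τ` of the upper half plane. -/
def doublePoint (τ : UpperHalfPlane) : UpperHalfPlane := ⟨2 * τ, by simpa using τ.im_pos⟩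

/-- As $\frac12-(m\tau+n)=-\frac12(2m\tau+2n-1)$, the shifted terms are the odd part of the row of
$2\tau$. That part is the whole row minus its even part, which is a quarter of the row of $\tau$. -/
lemma tsum_half_sub_row (τ : UpperHalfPlane) (m : ℤ) :
    ∑' n : ℤ, (1 / ((1 : ℂ) / 2 - (m * τ + n)) ^ 2 - 1 / ((m : ℂ) * τ + n) ^ 2) =
      4 * e2Summand m (doublePoint τ) - 2 * e2Summand m τ := by
  have hs := e2Summand_summable m (doublePoint τ)
  have hs' := e2Summand_summable m τ
  have he : ∀ n : ℤ, eisSummand 2 ![m, 2 * n] (doublePoint τ) = 1 / 4 * eisSummand 2 ![m, n] τ := by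
    intro n
    simp only [eisSummand, doublePoint, Matrix.cons_val_zero, Matrix.cons_val_one]
    push_cast
    rw [show (m : ℂ) * (2 * τ) + 2 * n = 2 * (m * τ + n) by ring, mul_zpow]
    norm_num [zpow_neg]
  have hse : Summable fun n : ℤ ↦ eisSummand 2 ![m, 2 * n] (doublePoint τ) := by
    simp_rw [he]; exact hs'.mul_left _
  have hso : Summable fun n : ℤ ↦ eisSummand 2 ![m, 2 * n + 1] (doublePoint τ) :=
    hs.comp_injective (i := fun n : ℤ ↦ 2 * n + 1) (fun x y hxy ↦ by simpa using hxy)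
  have h1 := tsum_int_even_add_odd hs
  rw [hse.tsum_add hso] at h1
  simp_rw [he] at h1
  rw [tsum_mul_left] at h1
  have ho : ∀ n : ℤ, 1 / ((1 : ℂ) / 2 - (m * τ + n)) ^ 2 - 1 / ((m : ℂ) * τ + n) ^ 2 =
      4 * eisSummand 2 ![m, 2 * (n - 1) + 1] (doublePoint τ) - eisSummand 2 ![m, n] τ := by
    intro n
    simp only [eisSummand, doublePoint, Matrix.cons_val_zero, Matrix.cons_val_one]
    push_cast
    rw [show (m : ℂ) * (2 * τ) + (2 * (n - 1) + 1) = (-2) * (1 / 2 - (m * τ + n)) by ring, mul_zpow]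
    norm_num [zpow_neg]
    ring_nf
  simp_rw [ho]
  have hso' : Summable fun n : ℤ ↦ eisSummand 2 ![m, 2 * (n - 1) + 1] (doublePoint τ) :=
    (Equiv.subRight (1 : ℤ)).summable_iff.2 hso
  have hshift : ∑' n : ℤ, eisSummand 2 ![m, 2 * (n - 1) + 1] (doublePoint τ) =
      ∑' n : ℤ, eisSummand 2 ![m, 2 * n + 1] (doublePoint τ) :=
    (Equiv.subRight (1 : ℤ)).tsum_eq
      (fun n : ℤ ↦ eisSummand 2 ![m, 2 * n + 1] (doublePoint τ))
  rw [(hso'.mul_left 4).tsum_sub hs', tsum_mul_left, hshift]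
  unfold e2Summand
  rw [h1]
  ring

lemma tsum_half_eq_G2 (τ : UpperHalfPlane)
    (hs : Summable fun x : ℤ × ℤ ↦
      1 / ((1 : ℂ) / 2 - (x.1 * τ + x.2)) ^ 2 - 1 / ((x.1 : ℂ) * τ + x.2) ^ 2) :
    ∑' x : ℤ × ℤ, (1 / ((1 : ℂ) / 2 - (x.1 * τ + x.2)) ^ 2 - 1 / ((x.1 : ℂ) * τ + x.2) ^ 2) =
      4 * G2 (doublePoint τ) - 2 * G2 τ := by
  have h1 := hs.hasSum.prod_fiberwise (fun m ↦ (hs.prod_factor m).hasSum)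
  simp only [tsum_half_sub_row] at h1
  -- The row sums converge unconditionally; passing to symmetric summation allows comparison with
  -- `G2`, which is defined that way.
  have h2 : HasSum (fun m : ℤ ↦ 4 * e2Summand m (doublePoint τ) - 2 * e2Summand m τ) _
      (symmetricIcc ℤ) := Tendsto.mono_left h1 (by
        rw [unconditional_filter]; exact LeAtTop.le_atTop)
  have h3 := ((summable_e2Summand_symmetricIcc (doublePoint τ)).hasSum.mul_left 4).sub
    ((summable_e2Summand_symmetricIcc τ).hasSum.mul_left 2)
  exact h2.unique h3

lemma weierstrassP_half {a b : ℂ} (τ : UpperHalfPlane) (hτ : b / a = τ) (h : (b / a).im ≠ 0) :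
    (periodPair a b h).weierstrassP (a / 2) =
      Real.pi ^ 2 / 3 / a ^ 2 * (4 * E2 (doublePoint τ) - 2 * E2 τ) := by
  have ha := ne_zero_of_im_div_ne_zero h
  have h1 := (periodPair a b h).hasSum_weierstrassP (a / 2)
  rw [← (periodPair a b h).latticeEquivProd.symm.toEquiv.hasSum_iff] at h1
  have h2 : ((fun l : (periodPair a b h).lattice ↦ 1 / (a / 2 - (l : ℂ)) ^ 2 - 1 / (l : ℂ) ^ 2) ∘
      (periodPair a b h).latticeEquivProd.symm.toEquiv) = fun x : ℤ × ℤ ↦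
      1 / a ^ 2 * (1 / ((1 : ℂ) / 2 - (x.1 * τ + x.2)) ^ 2 - 1 / ((x.1 : ℂ) * τ + x.2) ^ 2) := by
    ext x
    have e := (periodPair a b h).latticeEquiv_symm_apply x
    have e' : (x.1 : ℂ) * (periodPair a b h).ω₁ + x.2 * (periodPair a b h).ω₂ =
        a * (x.1 * τ + x.2) := by
      rw [← hτ]; simp only [periodPair]; field_simp
    rw [e'] at e
    simp only [Function.comp_apply, LinearEquiv.coe_toEquiv, e]
    rw [show a / 2 - a * ((x.1 : ℂ) * τ + x.2) = a * (1 / 2 - (x.1 * τ + x.2)) by ring, mul_pow,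
      mul_pow]
    simp only [one_div, mul_inv, mul_sub]
  rw [h2] at h1
  have hs := (summable_mul_left_iff (one_div_ne_zero (pow_ne_zero 2 ha))).1 h1.summable
  rw [← h1.tsum_eq, tsum_mul_left, tsum_half_eq_G2 τ hs]
  simp only [E2, Pi.smul_apply, smul_eq_mul, riemannZeta_two]
  have : (Real.pi : ℂ) ≠ 0 := ofReal_ne_zero.2 Real.pi_ne_zero
  field_simp
  ring

lemma wp_periodLattice_half {a b ω : ℂ} (τ : UpperHalfPlane) (hτ : b / a = τ)
    (hω : ω / 2 - a / 2 ∈ periodLattice a b) :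
    wp (periodLattice a b) (ω / 2) =
      Real.pi ^ 2 / 3 / a ^ 2 * (4 * E2 (doublePoint τ) - 2 * E2 τ) := by
  have h : (b / a).im ≠ 0 := by rw [hτ]; exact τ.im_pos.ne'
  rw [wp_periodLattice h, ← weierstrassP_half τ hτ h]
  have := (periodPair a b h).weierstrassP_add_coe (a / 2)
    ⟨_, (mem_lattice_periodPair h).2 hω⟩
  rw [← this]
  congr 1
  ring

/-- Each term contains a factor $q$, so it is compared with the same series at $\tau=i$, where
$|q|=r$: for $x\le r$ one has $x^n\le r^{n-1}x$. -/
lemma norm_tsum_sigma_le (k : ℕ) : ∃ K : ℝ, 0 ≤ K ∧ ∀ τ : UpperHalfPlane, 1 ≤ τ.im →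
    ‖∑' n : ℕ+, (ArithmeticFunction.sigma k n : ℂ) * cexp (2 * Real.pi * I * τ) ^ (n : ℕ)‖ ≤
      K * Real.exp (-2 * Real.pi * τ.im) := by
  set r : ℝ := Real.exp (-2 * Real.pi) with hr
  have hnorm (τ : UpperHalfPlane) :
      ‖cexp (2 * Real.pi * I * τ)‖ = Real.exp (-2 * Real.pi * τ.im) := by
    rw [Complex.norm_exp]; congr 1; simp
  have hI : ‖cexp (2 * Real.pi * I * UpperHalfPlane.I)‖ = r := by rw [hnorm]; simp [hr]
  have hs : Summable fun n : ℕ+ ↦ (ArithmeticFunction.sigma k n : ℝ) * r ^ (n : ℕ) := by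
    have h1 := (summable_sigma_mul_cexp_pow (k := k + 1) (by omega) UpperHalfPlane.I).norm
    simp only [norm_mul, norm_pow, Complex.norm_natCast, hI, Nat.add_sub_cancel] at h1
    exact h1.comp_injective PNat.coe_injective
  refine ⟨(∑' n : ℕ+, (ArithmeticFunction.sigma k n : ℝ) * r ^ (n : ℕ)) * r⁻¹,
    mul_nonneg (tsum_nonneg fun n ↦ by positivity) (by positivity), fun τ hτ ↦ ?_⟩
  set x : ℝ := Real.exp (-2 * Real.pi * τ.im) with hx
  have hxr : x ≤ r := Real.exp_le_exp.2 (by nlinarith [Real.pi_pos])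
  refine (tsum_of_norm_bounded (hs.hasSum.mul_right (r⁻¹ * x)) fun n ↦ ?_).trans_eq (by ring)
  rw [norm_mul, norm_pow, Complex.norm_natCast, hnorm, ← hx, mul_assoc]
  refine mul_le_mul_of_nonneg_left ?_ (Nat.cast_nonneg _)
  obtain ⟨j, hj⟩ : ∃ j, (n : ℕ) = j + 1 := ⟨n - 1, (Nat.succ_pred_eq_of_pos n.pos).symm⟩
  have hr0 : 0 < r := Real.exp_pos _
  rw [hj, pow_succ, pow_succ, mul_assoc (r ^ j), mul_inv_cancel_left₀ hr0.ne']
  gcongr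

/-- Near the cusp, the squared difference `g₂ - 3 e₁²` of the last two roots decays exponentially. -/
theorem norm_g₂_sub_three_mul_wp_sq_le : ∃ C : ℝ, 0 ≤ C ∧ ∀ a b ω : ℂ, 1 ≤ (b / a).im →
    ω / 2 - a / 2 ∈ periodLattice a b →
    ‖g₂ (periodLattice a b) - 3 * wp (periodLattice a b) (ω / 2) ^ 2‖ ≤
      C / ‖a‖ ^ 4 * Real.exp (-2 * Real.pi * (b / a).im) := by
  obtain ⟨K₁, hK₁, h₁⟩ := norm_tsum_sigma_le 1
  obtain ⟨K₃, hK₃, h₃⟩ := norm_tsum_sigma_le 3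
  refine ⟨‖(4 * Real.pi ^ 4 / 3 : ℂ)‖ *
    (240 * K₃ + 2 * (72 * K₁) + (72 * K₁) ^ 2), by positivity, fun a b ω h hω ↦ ?_⟩
  set τ : UpperHalfPlane := ⟨b / a, by linarith⟩ with hτdef
  have hτ : b / a = τ := rfl
  have him : (b / a).im = τ.im := rfl
  have hd : (doublePoint τ).im = 2 * τ.im := by
    change (2 * (τ : ℂ)).im = _; simp
  rw [him] at h ⊢
  set x := Real.exp (-2 * Real.pi * τ.im) with hx
  have hx1 : x ≤ 1 := Real.exp_le_one_iff.2 (by nlinarith [Real.pi_pos])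
  have hx0 : 0 < x := Real.exp_pos _
  have hE4 : ModularForm.E₄ τ = 1 + 240 *
      ∑' n : ℕ+, (ArithmeticFunction.sigma 3 n : ℂ) * cexp (2 * Real.pi * I * τ) ^ (n : ℕ) := by
    have := q_expansion_bernoulli (k := 4) (by norm_num) (by decide) τ
    rw [this, bernoulli_eq_bernoulli'_of_ne_one (by norm_num), bernoulli'_four]
    norm_num
  rw [g₂_periodLattice τ hτ, wp_periodLattice_half τ hτ hω, hE4, E2_eq_tsum_cexp, E2_eq_tsum_cexp]
  have b3 := h₃ τ h
  have b1 := h₁ τ h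
  have b2 := h₁ (doublePoint τ) (by rw [hd]; linarith)
  rw [hd] at b2
  set S₃ := ∑' n : ℕ+, (ArithmeticFunction.sigma 3 n : ℂ) * cexp (2 * Real.pi * I * τ) ^ (n : ℕ)
  set S₁ := ∑' n : ℕ+, (ArithmeticFunction.sigma 1 n : ℂ) * cexp (2 * Real.pi * I * τ) ^ (n : ℕ)
  set S₂ := ∑' n : ℕ+, (ArithmeticFunction.sigma 1 n : ℂ) *
    cexp (2 * Real.pi * I * doublePoint τ) ^ (n : ℕ)
  have b2' : ‖S₂‖ ≤ K₁ * x := by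
    refine b2.trans ?_
    gcongr
    rw [hx]
    exact Real.exp_le_exp.2 (by nlinarith [Real.pi_pos])
  -- The constant terms cancel: $3\left(\frac13(4-2)\right)^2=\frac43$.
  have e : 4 * (Real.pi : ℂ) ^ 4 / 3 / a ^ 4 * (1 + 240 * S₃) -
      3 * (Real.pi ^ 2 / 3 / a ^ 2 * (4 * (1 - 24 * S₂) - 2 * (1 - 24 * S₁))) ^ 2 =
      (4 * Real.pi ^ 4 / 3) * (240 * S₃ - 2 * (24 * S₁ - 48 * S₂) - (24 * S₁ - 48 * S₂) ^ 2) /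
        a ^ 4 := by
    ring
  rw [e, norm_div, norm_mul, norm_pow, div_mul_eq_mul_div, mul_assoc]
  gcongr
  have b4 : ‖24 * S₁ - 48 * S₂‖ ≤ 72 * K₁ * x := by
    refine (norm_sub_le _ _).trans ?_
    rw [norm_mul, norm_mul]
    norm_num
    nlinarith
  calc _ ≤ ‖240 * S₃‖ + ‖2 * (24 * S₁ - 48 * S₂)‖ + ‖(24 * S₁ - 48 * S₂) ^ 2‖ :=
        (norm_sub_le _ _).trans (by gcongr; exact norm_sub_le _ _)
    _ ≤ 240 * (K₃ * x) + 2 * (72 * K₁ * x) + (72 * K₁ * x) ^ 2 := by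
        rw [norm_mul, norm_mul, norm_pow]
        norm_num
        gcongr
    _ ≤ _ := by
        have : x ^ 2 ≤ x := by nlinarith
        have h72 := mul_le_mul_of_nonneg_left this (sq_nonneg (72 * K₁))
        nlinarith

end Landen

/-! ### Subgroups of index two and shortest vectors. -/

namespace Landen

open Complex Filter Topology

/-- `w` is a shortest nonzero vector of `Γ`. -/
def IsShortest (w : ℂ) (Γ : AddSubgroup ℂ) : Prop :=
  w ∈ Γ ∧ w ≠ 0 ∧ ∀ v ∈ Γ, v ≠ 0 → ‖w‖ ≤ ‖v‖

lemma add_mem_iff_of_isIndexTwo {G Γ : AddSubgroup ℂ} (h : IsIndexTwo G Γ) {x y : ℂ}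
    (hx : x ∈ Γ) (hy : y ∈ Γ) : x + y ∈ G ↔ (x ∈ G ↔ y ∈ G) := by
  have := AddSubgroup.add_mem_iff_of_index_two (H := G.addSubgroupOf Γ) h.2 (a := ⟨x, hx⟩)
    (b := ⟨y, hy⟩)
  simpa [AddSubgroup.mem_addSubgroupOf] using this

lemma two_mul_mem_of_isIndexTwo {G Γ : AddSubgroup ℂ} (h : IsIndexTwo G Γ) {x : ℂ}
    (hx : x ∈ Γ) : 2 * x ∈ G := by
  rw [two_mul, add_mem_iff_of_isIndexTwo h hx hx]

lemma left_mem_periodLattice (a b : ℂ) : a ∈ periodLattice a b :=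
  AddSubgroup.subset_closure (by simp)

lemma right_mem_periodLattice (a b : ℂ) : b ∈ periodLattice a b :=
  AddSubgroup.subset_closure (by simp)

lemma periodLattice_comm (a b : ℂ) : periodLattice a b = periodLattice b a := by
  rw [periodLattice, periodLattice, Set.pair_comm]

lemma int_mul_mem {G : AddSubgroup ℂ} {x : ℂ} (hx : x ∈ G) (m : ℤ) : (m : ℂ) * x ∈ G := by
  simpa using G.zsmul_mem hx m

lemma periodLattice_le_iff {a b : ℂ} {G : AddSubgroup ℂ} :
    periodLattice a b ≤ G ↔ a ∈ G ∧ b ∈ G := by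
  simp [periodLattice, AddSubgroup.closure_le, Set.insert_subset_iff]

lemma periodLattice_add_int_mul (a b : ℂ) (k : ℤ) :
    periodLattice a (b + k * a) = periodLattice a b := by
  refine le_antisymm (periodLattice_le_iff.2 ⟨left_mem_periodLattice _ _, ?_⟩)
    (periodLattice_le_iff.2 ⟨left_mem_periodLattice _ _, ?_⟩)
  · exact add_mem (right_mem_periodLattice _ _) (int_mul_mem (left_mem_periodLattice _ _) k)
  · have := sub_mem (right_mem_periodLattice a (b + k * a))
      (int_mul_mem (left_mem_periodLattice a (b + k * a)) k)
    simpa using this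

lemma eq_of_isIndexTwo_of_left_mem {a b : ℂ} {G : AddSubgroup ℂ}
    (h : IsIndexTwo G (periodLattice a b)) (ha : a ∈ G) : G = periodLattice a (2 * b) := by
  have hb2 := two_mul_mem_of_isIndexTwo h (right_mem_periodLattice a b)
  have hb : b ∉ G := by
    intro hb
    have : G = periodLattice a b := le_antisymm h.1 (periodLattice_le_iff.2 ⟨ha, hb⟩)
    have h2 := h.2
    rw [this, AddSubgroup.relIndex_self] at h2
    omega
  refine le_antisymm (fun z hz ↦ ?_) (periodLattice_le_iff.2 ⟨ha, hb2⟩)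
  obtain ⟨m, n, rfl⟩ := mem_periodLattice.1 (h.1 hz)
  have hn : (n : ℂ) * b ∈ G := by simpa using sub_mem hz (int_mul_mem ha m)
  rcases Int.even_or_odd' n with ⟨k, rfl | rfl⟩
  · exact mem_periodLattice.2 ⟨m, k, by push_cast; ring⟩
  · refine absurd ?_ hb
    have := sub_mem hn (int_mul_mem hb2 k)
    have e : ((2 * k + 1 : ℤ) : ℂ) * b - k * (2 * b) = b := by push_cast; ring
    rwa [e] at this

lemma isIndexTwo_periodLattice_two_mul {a b : ℂ} (h : (b / a).im ≠ 0) :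
    IsIndexTwo (periodLattice a (2 * b)) (periodLattice a b) := by
  refine ⟨periodLattice_le_iff.2 ⟨left_mem_periodLattice _ _, ?_⟩, ?_⟩
  · simpa using int_mul_mem (right_mem_periodLattice a b) 2
  rw [AddSubgroup.relIndex_eq_two_iff_exists_notMem_and]
  refine ⟨b, right_mem_periodLattice _ _, fun hb ↦ ?_, fun z hz ↦ ?_⟩
  · obtain ⟨m, n, e⟩ := mem_periodLattice.1 hb
    have := int_coeffs_eq h (m := m) (n := 2 * n) (p := 0) (q := 1) (by
      push_cast; linear_combination e)
    omega
  · obtain ⟨m, n, rfl⟩ := mem_periodLattice.1 hz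
    rcases Int.even_or_odd' n with ⟨k, rfl | rfl⟩
    · right; exact mem_periodLattice.2 ⟨m, k, by push_cast; ring⟩
    · left; exact mem_periodLattice.2 ⟨m, k + 1, by push_cast; ring⟩

/-- A shortest vector of a lattice is part of a positively oriented basis. -/
lemma exists_basis_of_isShortest {a b w : ℂ} (h : (b / a).im ≠ 0)
    (hw : IsShortest w (periodLattice a b)) :
    ∃ c : ℂ, 0 < (c / w).im ∧ periodLattice a b = periodLattice w c := by
  obtain ⟨hwm, hw0, hmin⟩ := hw
  obtain ⟨p, q, hpq⟩ := mem_periodLattice.1 hwm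
  -- Dividing $w$ by the gcd of its coordinates would give a shorter period; Bézout then completes
  -- $w$ to a basis.
  have hcop : IsCoprime p q := by
    rw [Int.isCoprime_iff_gcd_eq_one]
    obtain ⟨p', hp'⟩ := Int.gcd_dvd_left (a := p) (b := q)
    obtain ⟨q', hq'⟩ := Int.gcd_dvd_right (a := p) (b := q)
    set d := Int.gcd p q
    have hwd : w = d * (p' * a + q' * b) := by
      rw [← hpq, hp', hq']; push_cast; ring
    have hv0 : (p' : ℂ) * a + q' * b ≠ 0 := by
      intro h0; rw [h0, mul_zero] at hwd; exact hw0 hwd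
    have hle := hmin _ (mem_periodLattice.2 ⟨p', q', rfl⟩) hv0
    rw [hwd, norm_mul, Complex.norm_natCast] at hle
    have hpos := norm_pos_iff.2 hv0
    have hd1 : (d : ℝ) ≤ 1 := by nlinarith
    have hd0 : d ≠ 0 := by
      intro h0; rw [h0] at hwd; simp at hwd; exact hw0 hwd
    have : d ≤ 1 := by exact_mod_cast hd1
    omega
  obtain ⟨s, r, hsr⟩ := hcop
  set c : ℂ := -r * a + s * b with hc
  have hdet : (s : ℂ) * p + r * q = 1 := by exact_mod_cast hsr
  have hsub : periodLattice a b = periodLattice w c := by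
    refine le_antisymm (periodLattice_le_iff.2 ⟨mem_periodLattice.2 ⟨s, -q, ?_⟩,
      mem_periodLattice.2 ⟨r, p, ?_⟩⟩) (periodLattice_le_iff.2 ⟨hwm,
      mem_periodLattice.2 ⟨-r, s, by rw [hc]; push_cast; ring⟩⟩)
    · rw [← hpq, hc]; push_cast; linear_combination a * hdet
    · rw [← hpq, hc]; linear_combination b * hdet
  have hne : (c / w).im ≠ 0 := by
    intro h0
    have hreal : c = ((c / w).re : ℝ) * w := by
      have : c / w = ((c / w).re : ℝ) := Complex.ext (by simp) (by simpa using h0)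
      rw [← this]; field_simp
    set t : ℝ := (c / w).re
    have := real_coeffs_eq_zero h (s := -r - t * p) (t := s - t * q) (by
      rw [← hpq, hc] at hreal; push_cast; linear_combination hreal)
    have hdetR : (s : ℝ) * p + r * q = 1 := by exact_mod_cast hsr
    have h1 : (r : ℝ) = -t * p := by linarith [this.1]
    have h2 : (s : ℝ) = t * q := by linarith [this.2]
    rw [h1, h2] at hdetR
    nlinarith
  rcases lt_or_gt_of_ne hne with hlt | hgt
  · refine ⟨-c, by rw [neg_div, neg_im]; linarith, hsub.trans ?_⟩
    refine le_antisymm (periodLattice_le_iff.2 ⟨left_mem_periodLattice _ _, ?_⟩)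
      (periodLattice_le_iff.2 ⟨left_mem_periodLattice _ _, neg_mem (right_mem_periodLattice _ _)⟩)
    simpa using neg_mem (right_mem_periodLattice w (-c))
  · exact ⟨c, hgt, hsub⟩

lemma IsLattice.exists_basis {Γ : AddSubgroup ℂ} (hΓ : IsLattice Γ) :
    ∃ a b : ℂ, (b / a).im ≠ 0 ∧ Γ = periodLattice a b := by
  obtain ⟨hd, hr⟩ := hΓ
  let L : Submodule ℤ ℂ := AddSubgroup.toIntSubmodule Γ
  have hdL : DiscreteTopology L := hd
  have hrL : Module.finrank ℤ L = 2 := hr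
  have hfin : Module.Finite ℤ L := Module.finite_of_finrank_pos (by omega)
  have hfree : Module.Free ℤ L := inferInstance
  let v := Module.finBasisOfFinrankEq ℤ L hrL
  have hspan : Submodule.span ℤ {(v 0 : ℂ), (v 1 : ℂ)} = L := by
    have h1 := v.span_eq
    have h2 := congrArg (Submodule.map L.subtype) h1
    rw [Submodule.map_span, Submodule.map_top, Submodule.range_subtype] at h2
    refine Eq.trans ?_ h2
    congr 1
    ext x
    simp [Fin.exists_fin_two, eq_comm]
  have hΓ' : Γ = periodLattice (v 0) (v 1) := by
    ext z
    have : z ∈ Γ ↔ z ∈ Submodule.span ℤ {(v 0 : ℂ), (v 1 : ℂ)} := by rw [hspan]; exact Iff.rfl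
    rw [this, Submodule.mem_span_pair, mem_periodLattice]
    simp
  refine ⟨v 0, v 1, fun h0 ↦ ?_, hΓ'⟩
  -- Discreteness makes the real rank of the span equal to $2$, which excludes collinear generators.
  have hfr := Real.finrank_eq_int_finrank_of_discrete (s := {(v 0 : ℂ), (v 1 : ℂ)})
    (by rw [hspan]; exact hdL)
  rw [Set.finrank, Set.finrank, hspan, hrL] at hfr
  have hv0 : (v 0 : ℂ) ≠ 0 := by
    have := v.ne_zero 0
    simpa using this
  have hle : Submodule.span ℝ {(v 0 : ℂ), (v 1 : ℂ)} ≤ Submodule.span ℝ {(v 0 : ℂ)} := by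
    rw [Submodule.span_le]
    rintro x (rfl | rfl)
    · exact Submodule.mem_span_singleton_self _
    · rw [SetLike.mem_coe, Submodule.mem_span_singleton]
      refine ⟨((v 1 : ℂ) / (v 0 : ℂ)).re, ?_⟩
      have : (v 1 : ℂ) / (v 0 : ℂ) = (((v 1 : ℂ) / (v 0 : ℂ)).re : ℝ) :=
        Complex.ext (by simp) (by simpa using h0)
      rw [real_smul, ← this]; field_simp
  have := Submodule.finrank_mono hle
  rw [hfr, finrank_span_singleton hv0] at this
  omega

lemma finite_inter_closedBall {Γ : AddSubgroup ℂ} (hΓ : DiscreteTopology Γ) (R : ℝ) :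
    {w : ℂ | w ∈ Γ ∧ ‖w‖ ≤ R}.Finite := by
  have hcl : IsClosed (Γ : Set ℂ) := AddSubgroup.isClosed_of_discrete
  have hc : IsCompact ((Γ : Set ℂ) ∩ Metric.closedBall 0 R) :=
    (isCompact_closedBall 0 R).inter_left hcl
  have hdt : IsDiscrete ((Γ : Set ℂ) ∩ Metric.closedBall 0 R) :=
    ⟨DiscreteTopology.of_subset (s := (Γ : Set ℂ)) hΓ Set.inter_subset_left⟩
  refine (hc.finite hdt).subset fun w hw ↦ ⟨hw.1, by simpa using hw.2⟩

lemma exists_isShortest {Γ : AddSubgroup ℂ} (hΓ : DiscreteTopology Γ) {v : ℂ} (hv : v ∈ Γ)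
    (hv0 : v ≠ 0) : ∃ w, IsShortest w Γ := by
  have hf : {w : ℂ | w ∈ Γ ∧ w ≠ 0 ∧ ‖w‖ ≤ ‖v‖}.Finite :=
    (finite_inter_closedBall hΓ ‖v‖).subset fun w hw ↦ ⟨hw.1, hw.2.2⟩
  obtain ⟨w, hw, hmin⟩ := hf.exists_minimalFor (fun w : ℂ ↦ ‖w‖) _ ⟨v, hv, hv0, le_rfl⟩
  refine ⟨w, hw.1, hw.2.1, fun u hu hu0 ↦ ?_⟩
  rcases le_total ‖u‖ ‖w‖ with h | h
  · exact hmin ⟨hu, hu0, h.trans hw.2.2⟩ h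
  · exact h

/-- An optimal subgroup of index two contains a shortest vector of the lattice. -/
theorem IsOptimal.exists_isShortest_mem {a b : ℂ} {G : AddSubgroup ℂ} (hab : 0 < (b / a).im)
    (ha : IsShortest a (periodLattice a b)) (hG : IsOptimal G (periodLattice a b)) :
    ∃ w ∈ G, IsShortest w (periodLattice a b) := by
  by_contra! hno
  have ha0 := ne_zero_of_im_div_ne_zero hab.ne'
  have haG : a ∉ G := fun h ↦ hno a h ha
  obtain ⟨k₀, hk₀⟩ : ∃ k₀ : ℤ, b + k₀ * a ∈ G := by
    by_cases hb : b ∈ G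
    · exact ⟨0, by simpa using hb⟩
    · refine ⟨1, ?_⟩
      have := (add_mem_iff_of_isIndexTwo hG.1 (right_mem_periodLattice a b)
        (left_mem_periodLattice a b)).2 (by simp [hb, haG])
      simpa using this
  set τ₀ := b / a + k₀ with hτ₀
  -- Only even multiples of $a$ may be subtracted without leaving $G$, hence rounding half of the
  -- real part and the strip of width $2$.
  obtain ⟨r, hr⟩ : ∃ r : ℤ, |τ₀.re / 2 - r| ≤ 1 / 2 := ⟨_, abs_sub_round _⟩
  set k : ℤ := k₀ - 2 * r with hk
  set c := b + k * a with hc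
  have hcG : c ∈ G := by
    have h2a := int_mul_mem (two_mul_mem_of_isIndexTwo hG.1 (left_mem_periodLattice a b)) r
    have := sub_mem hk₀ h2a
    have e : c = b + k₀ * a - r * (2 * a) := by
      rw [hc, hk]; push_cast; ring
    rwa [e]
  have hcτ : c / a = b / a + k := by rw [hc]; field_simp
  have him : 0 < (c / a).im := by rw [hcτ]; simpa using hab
  have hre : |(c / a).re| ≤ 1 := by
    have e : (c / a).re = 2 * (τ₀.re / 2 - r) := by
      rw [hcτ, hτ₀, hk]; simp; ring
    rw [e, abs_mul, abs_two]
    linarith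
  have hlat : periodLattice a b = periodLattice a c := (periodLattice_add_int_mul a b k).symm
  have hn : 1 < ‖c / a‖ := by
    have hc0 : c ≠ 0 := by intro h0; rw [h0] at him; simp at him
    have hcm := hG.1.1 hcG
    rw [norm_div, one_lt_div (norm_pos_iff.2 ha0)]
    by_contra! hle
    exact hno c hcG ⟨hcm, hc0, fun v hv hv0 ↦ hle.trans (ha.2.2 v hv hv0)⟩
  rw [hlat] at hG
  have hGeq : G = periodLattice (2 * a) c := by
    rw [periodLattice_comm]
    exact eq_of_isIndexTwo_of_left_mem (by rw [periodLattice_comm]; exact hG.1) hcG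
  -- The competitor is $\langle a,2c\rangle$.
  have hopt := hG.2 _ (isIndexTwo_periodLattice_two_mul him.ne')
  have e1 : 2 * c / a = 2 * (c / a) := by ring
  have e2 : c / (2 * a) = c / a / 2 := by field_simp
  rw [hGeq, disc_periodLattice (by rw [e2]; exact im_half_pos him),
    disc_periodLattice (by rw [e1]; exact im_two_mul_pos him), e1, e2] at hopt
  have hlt := norm_discRatio_lt_one him hre hn
  rw [discRatio, norm_div, div_lt_one (norm_pos_iff.2 (modDisc_ne_zero (im_half_pos him)))] at hlt
  rw [norm_mul] at hlt hopt
  rw [norm_mul, show 2 * (Real.pi : ℂ) / a = 2 * (2 * Real.pi / (2 * a)) by field_simp, mul_pow,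
    norm_mul] at hopt
  have hpos : 0 < ‖(2 * (Real.pi : ℂ) / (2 * a)) ^ 12‖ :=
    norm_pos_iff.2 (pow_ne_zero _ (div_ne_zero (mul_ne_zero two_ne_zero
      (ofReal_ne_zero.2 Real.pi_ne_zero)) (mul_ne_zero two_ne_zero ha0)))
  have := mul_lt_mul_of_pos_left hlt hpos
  linarith

/-! ### The chain of optimal subgroups and its limit. -/

lemma convergesQuadratically_of_bound {a : ℕ → ℂ} {q : ℝ} (hq : 0 < q)
    (h : a =O[atTop] fun n : ℕ ↦ Real.exp (-q * 2 ^ n)) : ConvergesQuadratically a 0 := by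
  obtain ⟨C, hC, hb⟩ := Asymptotics.bound_of_isBigO_nat_atTop h
  have hb' : ∀ n, ‖a n - 0‖ ≤ C * Real.exp (-q * 2 ^ n) := fun n ↦ by
    simpa using hb (Real.exp_ne_zero (-q * 2 ^ n))
  refine ⟨?_, C, q, hC, hq, hb'⟩
  refine h.trans_tendsto ?_
  have : Tendsto (fun n : ℕ ↦ q * (2 : ℝ) ^ n) atTop atTop :=
    (tendsto_pow_atTop_atTop_of_one_lt (by norm_num)).const_mul_atTop hq
  simpa only [neg_mul] using! Real.tendsto_exp_neg_atTop_nhds_zero.comp this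

/-- In a chain of optimal subgroups there is a common shortest vector, and the chain is obtained
by doubling a complementary period. -/
theorem exists_chain_basis {Γ : ℕ → AddSubgroup ℂ} (hΓ₀ : IsLattice (Γ 0))
    (hΓ : ∀ n : ℕ, IsOptimal (Γ (n + 1)) (Γ n)) :
    ∃ φ ψ : ℂ, 0 < (ψ / φ).im ∧ IsShortest φ (Γ 0) ∧
      ∀ n, Γ n = periodLattice φ (2 ^ n * ψ) := by
  obtain ⟨a₀, b₀, h₀, hlat₀⟩ := hΓ₀.exists_basis
  obtain ⟨w₀, hw₀⟩ := exists_isShortest hΓ₀.1 (hlat₀ ▸ left_mem_periodLattice a₀ b₀)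
    (ne_zero_of_im_div_ne_zero h₀)
  have hle (n) : Γ (n + 1) ≤ Γ n := (hΓ n).1.1
  have hanti : Antitone Γ := antitone_nat_of_succ_le hle
  have hstep : ∀ n, ∃ w b : ℂ, 0 < (b / w).im ∧ Γ n = periodLattice w b ∧ IsShortest w (Γ n) ∧
      IsShortest w (Γ 0) := by
    intro n
    induction n with
    | zero =>
      obtain ⟨c, hc, hcl⟩ := exists_basis_of_isShortest h₀ (hlat₀ ▸ hw₀)
      exact ⟨w₀, c, hc, hlat₀.trans hcl, hw₀, hw₀⟩
    | succ n ih =>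
      obtain ⟨w, b, hb, hlat, hwn, hw⟩ := ih
      have hopt := hΓ n
      rw [hlat] at hopt hwn
      obtain ⟨v, hvG, hv⟩ := hopt.exists_isShortest_mem hb hwn
      obtain ⟨c, hc, hcl⟩ := exists_basis_of_isShortest hb.ne' hv
      have hG := hopt.1
      rw [hcl] at hG
      have hGeq := eq_of_isIndexTwo_of_left_mem hG hvG
      refine ⟨v, 2 * c, by rw [mul_div_assoc]; exact im_two_mul_pos hc, hGeq,
        ⟨hvG, hv.2.1, fun u hu hu0 ↦ hv.2.2 u (hopt.1.1 hu) hu0⟩,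
        hanti (Nat.zero_le _) hvG, hv.2.1, fun u hu hu0 ↦ ?_⟩
      -- `v` is no longer than `w`, which is shortest in `Γ 0`, so minimality passes along the chain
      -- even if the vector changes.
      exact (hv.2.2 w hwn.1 hwn.2.1).trans (hw.2.2 u hu hu0)
  let S : ℕ → Set ℂ := fun n ↦ {w | w ∈ Γ n ∧ IsShortest w (Γ 0)}
  have hSfin : (S 0).Finite := (finite_inter_closedBall hΓ₀.1 ‖w₀‖).subset fun w hw ↦
    ⟨hw.1, hw.2.2.2 _ hw₀.1 hw₀.2.1⟩
  have hSanti (n) : S (n + 1) ⊆ S n := fun w hw ↦ ⟨hle n hw.1, hw.2⟩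
  have hSn (n) : (S n).Finite :=
    hSfin.subset fun w hw ↦ ⟨hanti (Nat.zero_le n) hw.1, hw.2⟩
  -- The sets `S n` are nonempty, finite and nested, so a single vector lies in all of them.
  obtain ⟨φ, hφ⟩ := IsCompact.nonempty_iInter_of_sequence_nonempty_isCompact_isClosed S hSanti
    (fun n ↦ by
      obtain ⟨w, b, -, hlat, hwn, hw⟩ := hstep n
      exact ⟨w, hwn.1, hw⟩)
    hSfin.isCompact (fun n ↦ (hSn n).isClosed)
  rw [Set.mem_iInter] at hφ
  obtain ⟨ψ, hψ, hlat⟩ := exists_basis_of_isShortest h₀ (hlat₀ ▸ (hφ 0).2)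
  refine ⟨φ, ψ, hψ, (hφ 0).2, fun n ↦ ?_⟩
  induction n with
  | zero => simpa using hlat₀.trans hlat
  | succ n ih =>
    have hopt := (hΓ n).1
    rw [ih] at hopt
    rw [eq_of_isIndexTwo_of_left_mem hopt (hφ (n + 1)).1, pow_succ']
    ring_nf

lemma iInf_periodLattice_two_pow {φ ψ : ℂ} (h : (ψ / φ).im ≠ 0) :
    (⨅ n : ℕ, periodLattice φ (2 ^ n * ψ)) = AddSubgroup.zmultiples φ := by
  ext z
  rw [AddSubgroup.mem_iInf, AddSubgroup.mem_zmultiples_iff]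
  constructor
  · intro hz
    obtain ⟨m, k, hmk⟩ := mem_periodLattice.1 (hz 0)
    have hdvd (n : ℕ) : (2 : ℤ) ^ n ∣ k := by
      obtain ⟨m', k', hmk'⟩ := mem_periodLattice.1 (hz n)
      have := int_coeffs_eq h (m := m) (n := k) (p := m') (q := 2 ^ n * k') (by
        push_cast; linear_combination hmk - hmk')
      exact ⟨k', this.2⟩
    -- $2^{|k|}$ divides $k$ and exceeds $|k|$.
    have hk : k = 0 := by
      refine Int.eq_zero_of_abs_lt_dvd (hdvd k.natAbs) ?_
      rw [Int.abs_eq_natAbs]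
      exact_mod_cast Nat.lt_two_pow_self
    refine ⟨m, ?_⟩
    rw [← hmk, hk]; simp
  · rintro ⟨m, rfl⟩ n
    simpa using int_mul_mem (left_mem_periodLattice φ (2 ^ n * ψ)) m

lemma finrank_zmultiples {φ : ℂ} (h : φ ≠ 0) :
    Module.finrank ℤ (AddSubgroup.zmultiples φ) = 1 := by
  have h1 := (LinearEquiv.toSpanNonzeroSingleton ℤ ℂ φ h).finrank_eq.symm.trans
    (Module.finrank_self ℤ)
  have e : AddSubgroup.toIntSubmodule (AddSubgroup.zmultiples φ) = Submodule.span ℤ {φ} := by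
    ext x
    rw [Submodule.mem_span_singleton]
    exact AddSubgroup.mem_zmultiples_iff
  rw [← e] at h1
  exact h1

/-- By Vieta $e_2+e_3=-e_1$ and $e_2e_3=e_1^2-g_2/4$. -/
lemma sq_sub_eq_of_roots {Γ : AddSubgroup ℂ} {e₁ e₂ e₃ : ℂ}
    (h : (cubic Γ).roots = {e₁, e₂, e₃}) : (e₂ - e₃) ^ 2 = g₂ Γ - 3 * e₁ ^ 2 := by
  let P : Cubic ℂ := ⟨4, 0, -g₂ Γ, -g₃ Γ⟩
  have hP : P.toPoly = cubic Γ := by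
    simp [P, Cubic.toPoly, cubic]; ring
  have ha : P.a ≠ 0 := by simp [P]
  have hr : (Cubic.map (RingHom.id ℂ) P).roots = {e₁, e₂, e₃} := by
    rw [Cubic.map_roots, Polynomial.map_id, hP, h]
  have hb := Cubic.b_eq_three_roots ha hr
  have hc := Cubic.c_eq_three_roots ha hr
  simp [P] at hb hc
  have hsum : e₃ = -e₁ - e₂ := by linear_combination -hb
  rw [hsum] at hc ⊢
  linear_combination hc

end Landen

open Landen in
theorem lemmal36 (Γ : ℕ → AddSubgroup ℂ) (hΓ₀ : Landen.IsLattice (Γ 0))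
    (hΓ : ∀ n : ℕ, Landen.IsOptimal (Γ (n + 1)) (Γ n)) :
    -- the intersection is a discrete subgroup of rank one
    (DiscreteTopology (⨅ n, Γ n : AddSubgroup ℂ) ∧
      Module.finrank ℤ (⨅ n, Γ n : AddSubgroup ℂ) = 1 ∧
      -- it has a generator, and each generator is a shortest nonzero vector of `Γ 0`
      (∃ φ : ℂ, (⨅ n, Γ n) = AddSubgroup.zmultiples φ) ∧
      ∀ φ : ℂ, (⨅ n, Γ n) = AddSubgroup.zmultiples φ →
        φ ∈ Γ 0 ∧ φ ≠ 0 ∧ ‖φ‖ = sInf {r : ℝ | ∃ w ∈ Γ 0, w ≠ 0 ∧ ‖w‖ = r}) ∧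
    Landen.ConvergesQuadratically (fun n => Landen.disc (Γ n)) 0 ∧
    -- the roots are listed with multiplicity, so that their distinctness is not an assumption
    ∀ ω e₁ e₂ e₃ : ℕ → ℂ,
      (∀ n : ℕ, ω n ∈ Γ (n + 1) ∧ ∀ u ∈ Γ n, ω n ≠ 2 * u) →
      (∀ n : ℕ, (Landen.cubic (Γ n)).roots = {e₁ n, e₂ n, e₃ n}) →
      (∀ n : ℕ, e₁ n = Landen.wp (Γ n) (ω n / 2)) →
      Landen.ConvergesQuadratically (fun n => e₂ n - e₃ n) 0 := by
  obtain ⟨φ, ψ, him, hφ, hlat⟩ := exists_chain_basis hΓ₀ hΓ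
  have hinf : (⨅ n, Γ n) = AddSubgroup.zmultiples φ := by
    simp_rw [hlat]
    exact iInf_periodLattice_two_pow him.ne'
  have himn (n : ℕ) : (2 ^ n * ψ / φ).im = 2 ^ n * (ψ / φ).im := by
    have : (2 ^ n * ψ / φ : ℂ) = ((2 ^ n : ℝ) : ℂ) * (ψ / φ) := by push_cast; ring
    rw [this, Complex.im_ofReal_mul]
  have hposn (n : ℕ) : 0 < (2 ^ n * ψ / φ).im := by rw [himn]; positivity
  have hlarge (T : ℝ) : ∀ᶠ n : ℕ in Filter.atTop, T ≤ (2 ^ n * ψ / φ).im := by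
    simp_rw [himn]
    exact ((tendsto_pow_atTop_atTop_of_one_lt (by norm_num)).atTop_mul_const
      him).eventually_ge_atTop T
  refine ⟨⟨?_, ?_, ⟨φ, hinf⟩, ?_⟩, ?_, ?_⟩
  · have := hΓ₀.1
    exact DiscreteTopology.of_subset (s := (Γ 0 : Set ℂ)) this (iInf_le Γ 0)
  · rw [hinf]
    exact finrank_zmultiples hφ.2.1
  · intro φ' hφ'
    have hgen : AddSubgroup.zmultiples φ = AddSubgroup.zmultiples φ' := hinf.symm.trans hφ'
    have hmem : φ' ∈ AddSubgroup.zmultiples φ := hgen ▸ AddSubgroup.mem_zmultiples φ'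
    -- $\varphi=m\varphi'$ with $m\ne0$ gives $|\varphi'|\le|\varphi|$.
    obtain ⟨m, hm⟩ := AddSubgroup.mem_zmultiples_iff.1 (hgen ▸ AddSubgroup.mem_zmultiples φ)
    have hφ'0 : φ' ≠ 0 := by
      rintro rfl
      exact hφ.2.1 (by simpa using hm.symm)
    have hφ'Γ : φ' ∈ Γ 0 := (AddSubgroup.mem_iInf.1 (hinf ▸ hmem)) 0
    have hm0 : m ≠ 0 := by
      rintro rfl
      exact hφ.2.1 (by simpa using hm.symm)
    have hle : ‖φ'‖ ≤ ‖φ‖ := by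
      rw [← hm, zsmul_eq_mul, norm_mul, Complex.norm_intCast]
      have : (1 : ℝ) ≤ |(m : ℝ)| := by exact_mod_cast Int.one_le_abs hm0
      nlinarith [norm_nonneg φ']
    refine ⟨hφ'Γ, hφ'0, Eq.symm (IsLeast.csInf_eq (a := ‖φ'‖) ?_)⟩
    refine ⟨⟨φ', hφ'Γ, hφ'0, rfl⟩, ?_⟩
    rintro r ⟨w, hw, hw0, rfl⟩
    exact hle.trans (hφ.2.2 w hw hw0)
  · obtain ⟨T, hT⟩ := norm_modDisc_asymptotic one_pos
    refine convergesQuadratically_of_bound (q := 2 * Real.pi * (ψ / φ).im) (by positivity) ?_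
    refine Asymptotics.IsBigO.of_bound (‖(2 * (Real.pi : ℂ) / φ) ^ 12‖ * 2) ?_
    filter_upwards [hlarge T] with n hn
    rw [hlat, disc_periodLattice (hposn n), norm_mul, mul_assoc]
    gcongr
    refine (hT _ (hposn n) hn).2.trans_eq ?_
    rw [himn, Real.norm_of_nonneg (Real.exp_pos _).le]
    ring_nf
  · intro ω e₁ e₂ e₃ hω hroots he
    obtain ⟨C, hC, hbound⟩ := norm_g₂_sub_three_mul_wp_sq_le
    -- The estimate controls $(e_2-e_3)^2$, so the square root halves the rate $2\pi$.
    refine convergesQuadratically_of_bound (q := Real.pi * (ψ / φ).im) (by positivity) ?_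
    refine Asymptotics.IsBigO.of_bound (Real.sqrt (C / ‖φ‖ ^ 4)) ?_
    filter_upwards [hlarge 1] with n hn
    have hωmem : ω n / 2 - φ / 2 ∈ periodLattice φ (2 ^ n * ψ) := by
      obtain ⟨h1, h2⟩ := hω n
      rw [hlat] at h1 h2
      obtain ⟨m, k, hmk⟩ := mem_periodLattice.1 h1
      rw [pow_succ'] at hmk
      -- An even coefficient of $\varphi$ would put $\omega_n$ in $2\Gamma_n$; an odd one makes
      -- $\omega_n/2$ congruent to $\varphi/2$ modulo $\Gamma_n$.
      rcases Int.even_or_odd' m with ⟨j, rfl | rfl⟩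
      · refine absurd ?_ (h2 (j * φ + k * (2 ^ n * ψ)) (mem_periodLattice.2 ⟨j, k, rfl⟩))
        rw [← hmk]; push_cast; ring
      · refine mem_periodLattice.2 ⟨j, k, ?_⟩
        rw [← hmk]; push_cast; ring
    have h := hbound φ (2 ^ n * ψ) (ω n) hn hωmem
    rw [← hlat, ← he, ← sq_sub_eq_of_roots (hroots n), norm_pow] at h
    refine abs_le_of_sq_le_sq' ?_ (by positivity) |>.2
    rw [mul_pow, Real.sq_sqrt (by positivity), Real.norm_of_nonneg (Real.exp_pos _).le,
      ← Real.exp_nat_mul]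
    refine h.trans_eq ?_
    rw [himn]
    congr 2
    push_cast
    ring
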